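/- For a matrix $A\in\mathbb{R}^{2\times 2}$ let $|A|=\big(\sum_{i,j}A_{ij}^2\big)^{1/2}$ and $\operatorname{dist}(A,SO(2))=\inf_{R\in SO(2)}|A-R|$, and let $B_r\subset\mathbb{R}^2$ be the open disc of radius $r$ about the origin. Let $u\in W^{1,2}(B_1;\mathbb{R}^2)$ have weak gradient $Du$, put $$\delta=\int_{B_1}\operatorname{dist}^2(Du,SO(2))\,dx,\qquad \|Du\|_{L^2(B_1)}=\Big(\int_{B_1}|Du|^2\,dx\Big)^{1/2},$$ and suppose that $\delta\le 1$. Then there exists $R\in SO(2)$ such that $$\int_{B_{1/4}}|Du-R|^2\,dx\ \le\ 5\,\delta^{1/4}+2\,\delta^{1/4}\,\|Du\|_{L^2(B_1)}^{1/2}$$ and, for the same $R$, $$\int_{B_{1/4}}|Du-R|\,dx\ \le\ 5\,\delta^{1/4}+2\,\delta^{1/4}\,\|Du\|_{L^2(B_1)}^{1/2}.$$ -/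

import Mathlib

open MeasureTheory Metric
open scoped ContDiff

-- `|A|` is the Euclidean (Frobenius) norm of a matrix, and distances between matrices refer to it.
attribute [local instance] Matrix.frobeniusNormedAddCommGroup

/-- `u` belongs to the Sobolev space `W^{1,2}(Ω; ℝᵐ)`, `Ω ⊆ ℝⁿ` open, and the matrix field `Du`
(with entries `(Du)ᵢⱼ = ∂ⱼ uᵢ`) is its weak gradient: `u` and `Du` are square integrable on `Ω`,
and integration by parts holds against every test function `φ ∈ C_c^∞(Ω)`. -/
structure IsW12WithGradient {n m : ℕ} (Ω : Set (EuclideanSpace ℝ (Fin n)))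
    (u : EuclideanSpace ℝ (Fin n) → EuclideanSpace ℝ (Fin m))
    (Du : EuclideanSpace ℝ (Fin n) → Matrix (Fin m) (Fin n) ℝ) : Prop where
  memLp : MemLp u 2 (volume.restrict Ω)
  memLp_gradient : ∀ i j, MemLp (fun x => Du x i j) 2 (volume.restrict Ω)
  integral_by_parts : ∀ (i : Fin m) (j : Fin n) (φ : EuclideanSpace ℝ (Fin n) → ℝ),
    ContDiff ℝ ∞ φ → HasCompactSupport φ → tsupport φ ⊆ Ω →
      ∫ x in Ω, u x i * fderiv ℝ φ x (EuclideanSpace.single j 1) = -∫ x in Ω, Du x i j * φ x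

/-- `dist(A, SO(2))`, in the Frobenius norm. -/
noncomputable def distSO2 (A : Matrix (Fin 2) (Fin 2) ℝ) : ℝ :=
  infDist A (Matrix.specialOrthogonalGroup (Fin 2) ℝ : Set (Matrix (Fin 2) (Fin 2) ℝ))

/-- `∫_{B_1} dist²(F, SO(2)) dx`. -/
noncomputable def rotationDeficit (F : EuclideanSpace ℝ (Fin 2) → Matrix (Fin 2) (Fin 2) ℝ) : ℝ :=
  ∫ x in ball (0 : EuclideanSpace ℝ (Fin 2)) 1, distSO2 (F x) ^ 2

/-- `‖F‖_{L²(B_1)}`. -/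
noncomputable def l2NormUnitBall (F : EuclideanSpace ℝ (Fin 2) → Matrix (Fin 2) (Fin 2) ℝ) : ℝ :=
  √(∫ x in ball (0 : EuclideanSpace ℝ (Fin 2)) 1, ‖F x‖ ^ 2)

open ComplexConjugate Filter Topology

/-! Identify the plane with ℂ and split `Du` into its conformal part f and anticonformal part g.
Then dist²(Du, SO(2)) = 2(|f| - 1)² + 2|g|² (`distSO2_sq`), and equality of mixed second derivatives
becomes ∂f/∂z̄ = ∂g/∂z weakly. Because ∂/∂z and ∂/∂z̄ have the same L² norm on test functions,
removing from f its projection onto the closure of all ∂φ/∂z leaves a weakly holomorphic h with ‖f -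
h‖ ≤ ‖g‖ (`exists_weakly_holomorphic_approx`).

Put ε = δ^(1/4). For ε ≤ 1/4, |h| is within ε² of 1 in L²(B_1), so a weighted integral of |h|²
exceeds the mass of the weight by O(ε²) at most, while some x in B_{1/4} has 1 - |h(x)| = O(ε²). By
the mean value property (`ae_integral_kernel_mul_eq`) the weighted variance of h about h(x) is the
weighted integral of |h|² minus mass · |h(x)|², hence O(ε²). So f is close to the phase of h(x),
which is the rotation sought (`exists_unimodular_approx`).

For ε ≥ 1/4 one of ±1 already suffices (`exists_rotation_trivial`). Both estimates are proved with
5ε alone. -/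

/-! ### Test functions and Wirtinger derivatives. -/

/-- The Euclidean plane. -/
abbrev Plane := EuclideanSpace ℝ (Fin 2)

/-- The open unit disc. -/
abbrev unitDisc : Set Plane := ball 0 1

/-- Smooth functions with compact support in the open unit disc. -/
structure IsTestFunction {F : Type*} [NormedAddCommGroup F] [NormedSpace ℝ F] (φ : Plane → F) :
    Prop where
  contDiff : ContDiff ℝ ∞ φ
  hasCompactSupport : HasCompactSupport φ
  tsupport_subset : tsupport φ ⊆ unitDisc

/-- The `j`-th partial derivative. -/
noncomputable def partialDeriv {F : Type*} [NormedAddCommGroup F] [NormedSpace ℝ F] (j : Fin 2)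
    (φ : Plane → F) (x : Plane) : F :=
  fderiv ℝ φ x (EuclideanSpace.single j 1)

/-- The operator `∂₀ - i ∂₁`, twice the Wirtinger derivative `∂/∂z`. -/
noncomputable def delZ (φ : Plane → ℂ) (x : Plane) : ℂ :=
  partialDeriv 0 φ x - Complex.I * partialDeriv 1 φ x

/-- The operator `∂₀ + i ∂₁`, twice the Wirtinger derivative `∂/∂z̄`. -/
noncomputable def delZBar (φ : Plane → ℂ) (x : Plane) : ℂ :=
  partialDeriv 0 φ x + Complex.I * partialDeriv 1 φ x

namespace IsTestFunction

variable {F G : Type*} [NormedAddCommGroup F] [NormedSpace ℝ F] [NormedAddCommGroup G]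
  [NormedSpace ℝ G] {φ ψ : Plane → F}

lemma differentiable (hφ : IsTestFunction φ) : Differentiable ℝ φ :=
  hφ.contDiff.differentiable (by simp)

lemma clm_comp (hφ : IsTestFunction φ) (L : F →L[ℝ] G) : IsTestFunction (fun x => L (φ x)) where
  contDiff := L.contDiff.comp hφ.contDiff
  hasCompactSupport := hφ.hasCompactSupport.comp_left L.map_zero
  tsupport_subset := (tsupport_comp_subset L.map_zero φ).trans hφ.tsupport_subset

lemma partialDeriv (hφ : IsTestFunction φ) (j : Fin 2) : IsTestFunction (partialDeriv j φ) where
  contDiff := (hφ.contDiff.fderiv_right (m := ∞) (by simp)).clm_apply contDiff_const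
  hasCompactSupport := hφ.hasCompactSupport.fderiv_apply (𝕜 := ℝ) _
  tsupport_subset := (tsupport_fderiv_apply_subset ℝ _).trans hφ.tsupport_subset

lemma add (hφ : IsTestFunction φ) (hψ : IsTestFunction ψ) :
    IsTestFunction (fun x => φ x + ψ x) where
  contDiff := hφ.contDiff.add hψ.contDiff
  hasCompactSupport := hφ.hasCompactSupport.add hψ.hasCompactSupport
  tsupport_subset :=
    (tsupport_add φ ψ).trans (Set.union_subset hφ.tsupport_subset hψ.tsupport_subset)

lemma zero : IsTestFunction (fun _ : Plane => (0 : F)) where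
  contDiff := contDiff_const
  hasCompactSupport := HasCompactSupport.zero
  tsupport_subset := by simp [tsupport, Function.support_fun_zero]

lemma const_mul {φ : Plane → ℂ} (hφ : IsTestFunction φ) (c : ℂ) :
    IsTestFunction (fun x => c * φ x) :=
  hφ.clm_comp ((ContinuousLinearMap.mul ℝ ℂ) c)

lemma conjugate {φ : Plane → ℂ} (hφ : IsTestFunction φ) : IsTestFunction (fun x => conj (φ x)) :=
  hφ.clm_comp (Complex.conjCLE : ℂ →L[ℝ] ℂ)

lemma delZ {φ : Plane → ℂ} (hφ : IsTestFunction φ) : IsTestFunction (delZ φ) := by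
  have := (hφ.partialDeriv 0).add ((hφ.partialDeriv 1).const_mul (-Complex.I))
  convert this using 2
  simp [_root_.delZ, sub_eq_add_neg]

lemma delZBar {φ : Plane → ℂ} (hφ : IsTestFunction φ) : IsTestFunction (delZBar φ) :=
  (hφ.partialDeriv 0).add ((hφ.partialDeriv 1).const_mul Complex.I)

lemma memLp (hφ : IsTestFunction φ) (p : ENNReal) : MemLp φ p volume :=
  hφ.contDiff.continuous.memLp_of_hasCompactSupport hφ.hasCompactSupport

lemma integrable_mul {φ ψ : Plane → ℂ} (hφ : IsTestFunction φ) (hψ : IsTestFunction ψ) :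
    Integrable (fun x => φ x * ψ x) :=
  (hφ.contDiff.continuous.mul hψ.contDiff.continuous).integrable_of_hasCompactSupport
    hφ.hasCompactSupport.mul_right

end IsTestFunction

section PartialDeriv

variable {F G : Type*} [NormedAddCommGroup F] [NormedSpace ℝ F] [NormedAddCommGroup G]
  [NormedSpace ℝ G]

lemma partialDeriv_clm_comp {φ : Plane → F} (hφ : Differentiable ℝ φ) (L : F →L[ℝ] G) (j : Fin 2)
    (x : Plane) : partialDeriv j (fun y => L (φ y)) x = L (partialDeriv j φ x) := by
  have := (L.hasFDerivAt.comp x (hφ x).hasFDerivAt).fderiv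
  simp only [partialDeriv]
  rw [show (fun y => L (φ y)) = L ∘ φ from rfl, this]
  rfl

lemma partialDeriv_comm {φ : Plane → F} (hφ : ContDiff ℝ ∞ φ) (i j : Fin 2) (x : Plane) :
    partialDeriv i (partialDeriv j φ) x = partialDeriv j (partialDeriv i φ) x := by
  have hd : DifferentiableAt ℝ (fderiv ℝ φ) x :=
    ((hφ.fderiv_right (m := ∞) (by simp)).differentiable (by simp)) x
  have key : ∀ v w : Plane, fderiv ℝ (fun y => fderiv ℝ φ y v) x w =
      fderiv ℝ (fderiv ℝ φ) x w v := by
    intro v w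
    rw [fderiv_clm_apply hd (differentiableAt_const v)]
    simp
  have hs : IsSymmSndFDerivAt ℝ φ x :=
    (hφ.contDiffAt (x := x)).isSymmSndFDerivAt
      (by simpa using WithTop.coe_le_coe.2 (le_top : (2 : ℕ∞) ≤ ⊤))
  unfold partialDeriv
  rw [key, key]
  exact hs _ _

lemma partialDeriv_conj {φ : Plane → ℂ} (hφ : Differentiable ℝ φ) (j : Fin 2) (x : Plane) :
    partialDeriv j (fun y => conj (φ y)) x = conj (partialDeriv j φ x) :=
  partialDeriv_clm_comp hφ (Complex.conjCLE : ℂ →L[ℝ] ℂ) j x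

lemma delZBar_conj {φ : Plane → ℂ} (hφ : Differentiable ℝ φ) (x : Plane) :
    delZBar (fun y => conj (φ y)) x = conj (delZ φ x) := by
  simp [delZBar, delZ, partialDeriv_conj hφ]

lemma delZ_conj {φ : Plane → ℂ} (hφ : Differentiable ℝ φ) (x : Plane) :
    delZ (fun y => conj (φ y)) x = conj (delZBar φ x) := by
  simp [delZBar, delZ, partialDeriv_conj hφ, sub_eq_add_neg]

lemma partialDeriv_add {φ ψ : Plane → F} (hφ : Differentiable ℝ φ) (hψ : Differentiable ℝ ψ)
    (j : Fin 2) (x : Plane) :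
    partialDeriv j (fun y => φ y + ψ y) x = partialDeriv j φ x + partialDeriv j ψ x := by
  simp [partialDeriv, fderiv_fun_add (hφ x) (hψ x)]

lemma delZ_add {φ ψ : Plane → ℂ} (hφ : Differentiable ℝ φ) (hψ : Differentiable ℝ ψ) (x : Plane) :
    delZ (fun y => φ y + ψ y) x = delZ φ x + delZ ψ x := by
  simp [delZ, partialDeriv_add hφ hψ]; ring

lemma delZ_const_mul {φ : Plane → ℂ} (hφ : Differentiable ℝ φ) (c : ℂ) (x : Plane) :
    delZ (fun y => c * φ y) x = c * delZ φ x := by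
  have h : ∀ j, partialDeriv j (fun y => c * φ y) x = c * partialDeriv j φ x := fun j =>
    partialDeriv_clm_comp hφ ((ContinuousLinearMap.mul ℝ ℂ) c) j x
  simp [delZ, h]; ring

end PartialDeriv

/-! ### Projection in L² onto weakly holomorphic functions. -/

/-- Integrating by parts, either side is minus the integral of φ against the mixed second derivative
of ψ. -/
lemma integral_partialDeriv_mul_partialDeriv {φ ψ : Plane → ℂ} (hφ : IsTestFunction φ)
    (hψ : IsTestFunction ψ) :
    ∫ x, partialDeriv 0 φ x * partialDeriv 1 ψ x = ∫ x, partialDeriv 1 φ x * partialDeriv 0 ψ x := by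
  have parts : ∀ i j : Fin 2, ∫ x, φ x * partialDeriv i (partialDeriv j ψ) x =
      -∫ x, partialDeriv i φ x * partialDeriv j ψ x := fun i j =>
    integral_mul_fderiv_eq_neg_fderiv_mul_of_integrable
      ((hφ.partialDeriv i).integrable_mul (hψ.partialDeriv j))
      (hφ.integrable_mul ((hψ.partialDeriv j).partialDeriv i))
      (hφ.integrable_mul (hψ.partialDeriv j)) (fun x _ => hφ.differentiable x)
      (fun x _ => (hψ.partialDeriv j).differentiable x)
  have h01 := parts 0 1
  have h10 := parts 1 0
  simp_rw [partialDeriv_comm hψ.contDiff 0 1] at h01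
  rw [h01] at h10
  exact neg_injective h10

/-- `∂/∂z` and `∂/∂z̄` have the same `L²` norm on test functions. -/
lemma integral_norm_sq_delZ {φ : Plane → ℂ} (hφ : IsTestFunction φ) :
    ∫ x, ‖delZ φ x‖ ^ 2 = ∫ x, ‖delZBar φ x‖ ^ 2 := by
  have key : ∫ x, ((‖delZ φ x‖ ^ 2 : ℝ) : ℂ) - ((‖delZBar φ x‖ ^ 2 : ℝ) : ℂ) = 0 := by
    -- The difference of the squares is a multiple of the Jacobian of (φ, φ̄), a null Lagrangian.
    have hpt : ∀ x, ((‖delZ φ x‖ ^ 2 : ℝ) : ℂ) - ((‖delZBar φ x‖ ^ 2 : ℝ) : ℂ) =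
        2 * Complex.I * (partialDeriv 0 φ x * partialDeriv 1 (fun y => conj (φ y)) x -
          partialDeriv 1 φ x * partialDeriv 0 (fun y => conj (φ y)) x) := by
      intro x
      rw [partialDeriv_conj hφ.differentiable, partialDeriv_conj hφ.differentiable]
      push_cast
      rw [← Complex.mul_conj', ← Complex.mul_conj']
      simp only [delZ, delZBar, map_sub, map_add, map_mul, Complex.conj_I]
      ring
    simp_rw [hpt]
    rw [integral_const_mul, integral_sub
      ((hφ.partialDeriv 0).integrable_mul (hφ.conjugate.partialDeriv 1))
      ((hφ.partialDeriv 1).integrable_mul (hφ.conjugate.partialDeriv 0)),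
      integral_partialDeriv_mul_partialDeriv hφ hφ.conjugate, sub_self, mul_zero]
  have hint : ∀ {ψ : Plane → ℂ}, IsTestFunction ψ → Integrable (fun x => ‖ψ x‖ ^ 2) := fun hψ =>
    (hψ.memLp 2).norm.integrable_sq
  rw [integral_sub (hint hφ.delZ).ofReal (hint hφ.delZBar).ofReal] at key
  simp only [integral_complex_ofReal] at key
  exact_mod_cast sub_eq_zero.mp key

/-- The classes in `L²` of the functions `∂φ/∂z`, `φ` a test function. -/
noncomputable def delZRange : Submodule ℂ (Lp ℂ 2 (volume : Measure Plane)) where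
  carrier := {F | ∃ φ : Plane → ℂ, IsTestFunction φ ∧ F =ᵐ[volume] delZ φ}
  add_mem' := by
    rintro F G ⟨φ, hφ, hF⟩ ⟨ψ, hψ, hG⟩
    refine ⟨_, hφ.add hψ, ?_⟩
    filter_upwards [hF, hG, Lp.coeFn_add F G] with x h1 h2 h3
    rw [h3, Pi.add_apply, h1, h2, delZ_add hφ.differentiable hψ.differentiable]
  zero_mem' := by
    refine ⟨_, IsTestFunction.zero, (Lp.coeFn_zero ℂ 2 (volume : Measure Plane)).trans ?_⟩
    exact .of_forall fun x => by simp [delZ, partialDeriv]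
  smul_mem' := by
    rintro c F ⟨φ, hφ, hF⟩
    refine ⟨_, hφ.const_mul c, ?_⟩
    filter_upwards [hF, Lp.coeFn_smul c F] with x h1 h2
    rw [h2, Pi.smul_apply, h1, delZ_const_mul hφ.differentiable, smul_eq_mul]

lemma norm_sq_Lp_two_eq_integral {F : Lp ℂ 2 (volume : Measure Plane)} {f : Plane → ℂ}
    (h : F =ᵐ[volume] f) : ‖F‖ ^ 2 = ∫ x, ‖f x‖ ^ 2 := by
  have h1 : inner ℂ F F = ((∫ x, ‖f x‖ ^ 2 : ℝ) : ℂ) := by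
    rw [L2.inner_def, ← integral_complex_ofReal]
    refine integral_congr_ae ?_
    filter_upwards [h] with x hx
    rw [hx, inner_self_eq_norm_sq_to_K]
    simp
  rw [inner_self_eq_norm_sq_to_K] at h1
  exact Complex.ofReal_injective (by simpa using h1)

/-- If `∂f/∂z̄ = ∂g/∂z` weakly in the unit disc, then `f` is at `L²` distance at most `‖g‖` from
a function that is weakly holomorphic in the unit disc. -/
theorem exists_weakly_holomorphic_approx {f g : Plane → ℂ} (hf : MemLp f 2 volume)
    (hg : MemLp g 2 volume)
    (hfg : ∀ φ, IsTestFunction φ → ∫ x, f x * delZBar φ x = ∫ x, g x * delZ φ x) :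
    ∃ h : Plane → ℂ, MemLp h 2 volume ∧
      (∀ φ, IsTestFunction φ → ∫ x, h x * delZBar φ x = 0) ∧
      ∫ x, ‖f x - h x‖ ^ 2 ≤ ∫ x, ‖g x‖ ^ 2 := by
  set X : Submodule ℂ (Lp ℂ 2 (volume : Measure Plane)) := delZRange.topologicalClosure with hX
  have : CompleteSpace X := delZRange.isClosed_topologicalClosure.completeSpace_coe
  set f' : Lp ℂ 2 (volume : Measure Plane) := hf.toLp f with hf'
  set g' : Lp ℂ 2 (volume : Measure Plane) := hg.toLp g with hg'
  have hff : f' =ᵐ[volume] f := hf.coeFn_toLp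
  have hgg : g' =ᵐ[volume] g := hg.coeFn_toLp
  set p : Lp ℂ 2 (volume : Measure Plane) := X.starProjection f' with hp
  have hpX : p ∈ X := X.starProjection_apply_mem f'
  have hperp : ∀ w ∈ X, inner ℂ w (f' - p) = 0 := fun w hw =>
    Submodule.inner_right_of_mem_orthogonal hw (X.sub_starProjection_mem_orthogonal f')
  -- On a generator, ⟨∂φ, f⟩ = ∫ f ∂̄φ̄ = ∫ g ∂φ̄ = ⟨∂̄φ, g⟩, and ‖∂̄φ‖ = ‖∂φ‖; the bound is a
  -- closed condition, so it passes to `X`.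
  have inner_f : ∀ w ∈ X, ‖inner ℂ w f'‖ ≤ ‖g'‖ * ‖w‖ := by
    intro w hw
    have hclosed : IsClosed {w : Lp ℂ 2 (volume : Measure Plane) | ‖inner ℂ w f'‖ ≤ ‖g'‖ * ‖w‖} :=
      isClosed_le (by fun_prop) (by fun_prop)
    refine closure_minimal ?_ hclosed hw
    rintro w ⟨φ, hφ, hwφ⟩
    have hb := hφ.conjugate
    obtain ⟨G, hG⟩ : ∃ G : Lp ℂ 2 (volume : Measure Plane),
        G =ᵐ[volume] fun x => conj (delZ (fun y => conj (φ y)) x) :=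
      ⟨_, (hb.delZ.conjugate.memLp 2).coeFn_toLp⟩
    have e1 : inner ℂ w f' = ∫ x, f x * delZBar (fun y => conj (φ y)) x := by
      rw [L2.inner_def]
      refine integral_congr_ae ?_
      filter_upwards [hwφ, hff] with x h1 h2
      rw [h1, h2, delZBar_conj hφ.differentiable, RCLike.inner_apply]
    have e2 : inner ℂ G g' = ∫ x, g x * delZ (fun y => conj (φ y)) x := by
      rw [L2.inner_def]
      refine integral_congr_ae ?_
      filter_upwards [hG, hgg] with x h1 h2
      rw [h1, h2, RCLike.inner_apply, Complex.conj_conj]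
    have e3 : ‖G‖ = ‖w‖ := by
      rw [← sq_eq_sq₀ (norm_nonneg _) (norm_nonneg _), norm_sq_Lp_two_eq_integral hG,
        norm_sq_Lp_two_eq_integral hwφ, integral_norm_sq_delZ hφ]
      simp_rw [delZ_conj hφ.differentiable, Complex.conj_conj]
    rw [Set.mem_ofPred_eq, e1, hfg _ hb, ← e2, ← e3, mul_comm]
    exact norm_inner_le_norm _ _
  -- Take w = p in the previous bound: ‖p‖² = ⟨p, f⟩ ≤ ‖g‖ ‖p‖.
  have p_le : ‖p‖ ≤ ‖g'‖ := by
    have h1 : inner ℂ p p = inner ℂ p f' := by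
      have := hperp p hpX
      rw [inner_sub_right, sub_eq_zero] at this
      exact this.symm
    have h2 := inner_f p hpX
    rw [← h1, inner_self_eq_norm_sq_to_K] at h2
    norm_num at h2
    by_contra! hlt
    nlinarith [norm_nonneg p, norm_nonneg g']
  have hh : ⇑(f' - p) =ᵐ[volume] fun x => f x - p x := by
    filter_upwards [Lp.coeFn_sub f' p, hff] with x h1 h2
    rw [h1, Pi.sub_apply, h2]
  refine ⟨fun x => f x - p x, hf.sub (Lp.memLp p), fun φ hφ => ?_, ?_⟩
  · have hb := hφ.conjugate
    obtain ⟨w, hw⟩ : ∃ w : Lp ℂ 2 (volume : Measure Plane),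
        w =ᵐ[volume] delZ (fun y => conj (φ y)) := ⟨_, (hb.delZ.memLp 2).coeFn_toLp⟩
    rw [← hperp w (delZRange.le_topologicalClosure ⟨_, hb, hw⟩), L2.inner_def]
    refine integral_congr_ae ?_
    filter_upwards [hw, hh] with x h1 h2
    rw [h1, h2, RCLike.inner_apply, delZ_conj hφ.differentiable, Complex.conj_conj]
  · simp only [sub_sub_cancel]
    rw [← norm_sq_Lp_two_eq_integral (F := p) Filter.EventuallyEq.rfl,
      ← norm_sq_Lp_two_eq_integral hgg]
    gcongr

/-! ### A radial kernel and its compactly supported ∂̄-primitive. -/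

/-- A smooth cutoff on the line, equal to `1` on `[-1/4, 1/4]` and supported in
`[-7/25, 7/25]`. -/
noncomputable def cutoff : ContDiffBump (0 : ℝ) := ⟨1 / 4, 7 / 25, by norm_num, by norm_num⟩

/-- The primitive of `cutoff` that vanishes at `0`. -/
noncomputable def cutoffPrimitive (s : ℝ) : ℝ := ∫ t in (0 : ℝ)..s, cutoff t

lemma cutoff_eq_one {s : ℝ} (hs : |s| ≤ 1 / 4) : cutoff s = 1 :=
  cutoff.one_of_mem_closedBall (by simpa [cutoff] using hs)

lemma cutoff_eq_zero {s : ℝ} (hs : 7 / 25 ≤ |s|) : cutoff s = 0 :=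
  cutoff.zero_of_le_dist (by simpa [cutoff] using hs)

lemma hasDerivAt_cutoffPrimitive (s : ℝ) : HasDerivAt cutoffPrimitive (cutoff s) s :=
  intervalIntegral.integral_hasDerivAt_right (cutoff.continuous.intervalIntegrable _ _)
    (cutoff.continuous.stronglyMeasurableAtFilter _ _) cutoff.continuous.continuousAt

lemma contDiff_cutoffPrimitive : ContDiff ℝ ∞ cutoffPrimitive := by
  rw [contDiff_infty_iff_deriv]
  refine ⟨fun s => (hasDerivAt_cutoffPrimitive s).differentiableAt, ?_⟩
  rw [show deriv cutoffPrimitive = cutoff from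
    funext fun s => (hasDerivAt_cutoffPrimitive s).deriv]
  exact cutoff.contDiff

lemma cutoffPrimitive_of_le {s : ℝ} (h0 : 0 ≤ s) (hs : s ≤ 1 / 4) : cutoffPrimitive s = s := by
  have : ∀ t ∈ Set.uIcc 0 s, cutoff t = 1 := fun t ht => by
    rw [Set.uIcc_of_le h0] at ht
    exact cutoff_eq_one (by rw [abs_of_nonneg ht.1]; linarith [ht.2])
  rw [cutoffPrimitive, intervalIntegral.integral_congr this]
  simp

lemma cutoffPrimitive_of_ge {s : ℝ} (hs : 7 / 25 ≤ s) :
    cutoffPrimitive s = cutoffPrimitive (7 / 25) := by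
  have : ∀ t ∈ Set.uIcc (7 / 25) s, cutoff t = 0 := fun t ht => by
    rw [Set.uIcc_of_le hs] at ht
    exact cutoff_eq_zero (ht.1.trans (le_abs_self t))
  have h2 : ∫ t in (7 / 25)..s, cutoff t = 0 := by
    rw [intervalIntegral.integral_congr this]; simp
  rw [cutoffPrimitive, ← intervalIntegral.integral_add_adjacent_intervals
    (cutoff.continuous.intervalIntegrable 0 (7 / 25)) (cutoff.continuous.intervalIntegrable _ _),
    h2, add_zero, cutoffPrimitive]

/-- The identification of the plane with `ℂ`. -/
noncomputable def toComplex : Plane ≃ₗᵢ[ℝ] ℂ := Complex.orthonormalBasisOneI.repr.symm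

lemma toComplex_apply (x : Plane) : toComplex x = x 0 + x 1 * Complex.I := by
  simp [toComplex]

lemma delZBar_eq_of_hasFDerivAt {φ : Plane → ℂ} {L : Plane →L[ℝ] ℂ} {x : Plane}
    (h : HasFDerivAt φ L x) :
    delZBar φ x = L (EuclideanSpace.single 0 1) + Complex.I * L (EuclideanSpace.single 1 1) := by
  simp [delZBar, partialDeriv, h.fderiv]

/-- A primitive, with respect to `∂/∂z̄`, of the difference of two radial kernels with the same
mass. -/
noncomputable def kernelPrimitive (c : ℝ) (y : Plane) : ℂ :=
  ((cutoffPrimitive (‖y‖ ^ 2) - cutoffPrimitive (c * ‖y‖ ^ 2) : ℝ) : ℂ) * (toComplex y)⁻¹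

/-- Near the origin both cutoff primitives are the identity, so the numerator is a multiple of |y|²
= z z̄ and the pole of 1/z cancels. -/
lemma kernelPrimitive_eventuallyEq {c : ℝ} (hc : 1 ≤ c) :
    kernelPrimitive c =ᶠ[nhds 0] fun y => ((1 - c : ℝ) : ℂ) * conj (toComplex y) := by
  have : ∀ᶠ y : Plane in nhds 0, c * ‖y‖ ^ 2 < 1 / 4 := by
    have h : Continuous fun y : Plane => c * ‖y‖ ^ 2 := by fun_prop
    exact h.continuousAt.eventually_lt continuousAt_const (by simp)
  filter_upwards [this] with y hy
  have h1 : ‖y‖ ^ 2 ≤ c * ‖y‖ ^ 2 := le_mul_of_one_le_left (by positivity) hc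
  rw [kernelPrimitive, cutoffPrimitive_of_le (by positivity) (by linarith),
    cutoffPrimitive_of_le (by positivity) hy.le]
  -- At the origin the convention 0⁻¹ = 0 gives the right value.
  by_cases hy0 : y = 0
  · simp [hy0]
  have hz : toComplex y ≠ 0 := by simpa using hy0
  rw [show ‖y‖ ^ 2 - c * ‖y‖ ^ 2 = (1 - c) * ‖y‖ ^ 2 by ring, Complex.ofReal_mul, mul_assoc]
  congr 1
  rw [mul_inv_eq_iff_eq_mul₀ hz, Complex.conj_mul', toComplex.norm_map]
  push_cast
  rfl

lemma contDiffAt_kernelPrimitive {c : ℝ} (hc : 1 ≤ c) (y : Plane) :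
    ContDiffAt ℝ ∞ (kernelPrimitive c) y := by
  by_cases hy : y = 0
  · rw [hy]
    refine ContDiffAt.congr_of_eventuallyEq ?_ (kernelPrimitive_eventuallyEq hc)
    exact (contDiff_const.mul ((Complex.conjCLE : ℂ →L[ℝ] ℂ).contDiff.comp
      toComplex.contDiff)).contDiffAt
  · have hz : toComplex y ≠ 0 := by simpa using hy
    refine ContDiffAt.mul ?_ (toComplex.contDiff.contDiffAt.inv hz)
    refine Complex.ofRealCLM.contDiff.contDiffAt.comp y ?_
    exact ((contDiff_cutoffPrimitive.comp (contDiff_norm_sq ℝ)).sub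
      (contDiff_cutoffPrimitive.comp (contDiff_const.mul (contDiff_norm_sq ℝ)))).contDiffAt

/-- Far out both cutoff primitives have reached the same constant: the two kernels have equal mass.
-/
lemma kernelPrimitive_eq_zero {c : ℝ} (hc : 1 ≤ c) {y : Plane} (hy : 7 / 25 ≤ ‖y‖ ^ 2) :
    kernelPrimitive c y = 0 := by
  have h1 : ‖y‖ ^ 2 ≤ c * ‖y‖ ^ 2 := le_mul_of_one_le_left (by positivity) hc
  rw [kernelPrimitive, cutoffPrimitive_of_ge hy, cutoffPrimitive_of_ge (hy.trans h1)]
  simp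

/-- Away from the origin ∂̄(1/z) = 0, while (∂₀ + i∂₁)Φ(|y|²) = 2Φ'(|y|²) z, whose factor z cancels
1/z. -/
lemma delZBar_kernelPrimitive {c : ℝ} (hc : 1 ≤ c) (y : Plane) :
    delZBar (kernelPrimitive c) y =
      2 * ((cutoff (‖y‖ ^ 2) - c * cutoff (c * ‖y‖ ^ 2) : ℝ) : ℂ) := by
  have e0 : toComplex (EuclideanSpace.single 0 1) = 1 := by simp [toComplex_apply]
  have e1 : toComplex (EuclideanSpace.single 1 1) = Complex.I := by simp [toComplex_apply]
  by_cases hy : y = 0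
  · have hd : HasFDerivAt (fun y => ((1 - c : ℝ) : ℂ) * conj (toComplex y))
        (((1 - c : ℝ) : ℂ) • ((Complex.conjCLE : ℂ →L[ℝ] ℂ).comp
          (toComplex.toContinuousLinearEquiv : Plane →L[ℝ] ℂ))) y :=
      ((Complex.conjCLE : ℂ →L[ℝ] ℂ).comp
          (toComplex.toContinuousLinearEquiv : Plane →L[ℝ] ℂ)).hasFDerivAt.const_mul _
    subst hy
    rw [delZBar_eq_of_hasFDerivAt (hd.congr_of_eventuallyEq (kernelPrimitive_eventuallyEq hc))]
    simp only [smul_apply, ContinuousLinearMap.comp_apply]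
    simp [e0, e1, cutoff_eq_one]
    ring_nf
    simp
    ring
  · have hz : toComplex y ≠ 0 := by simpa using hy
    set a : ℝ := cutoff (‖y‖ ^ 2) - c * cutoff (c * ‖y‖ ^ 2) with ha
    have hn : HasFDerivAt (fun y : Plane => ‖y‖ ^ 2) (2 • innerSL ℝ y) y :=
      (hasStrictFDerivAt_norm_sq y).hasFDerivAt
    have hA : HasFDerivAt (fun y : Plane => cutoffPrimitive (‖y‖ ^ 2) - cutoffPrimitive (c * ‖y‖ ^ 2))
        ((2 * a) • innerSL ℝ y) y := by
      refine (((hasDerivAt_cutoffPrimitive _).comp_hasFDerivAt y hn).sub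
        ((hasDerivAt_cutoffPrimitive _).comp_hasFDerivAt y (hn.const_mul c))).congr_fderiv ?_
      ext v
      simp [ha]
      ring
    have hA' : HasFDerivAt (fun y : Plane => ((cutoffPrimitive (‖y‖ ^ 2) -
        cutoffPrimitive (c * ‖y‖ ^ 2) : ℝ) : ℂ)) (Complex.ofRealCLM.comp ((2 * a) • innerSL ℝ y)) y :=
      Complex.ofRealCLM.hasFDerivAt.comp y hA
    have hI : HasFDerivAt (fun y : Plane => (toComplex y)⁻¹)
        (-(toComplex y ^ 2)⁻¹ • (toComplex.toContinuousLinearEquiv : Plane →L[ℝ] ℂ)) y :=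
      (hasDerivAt_inv hz).comp_hasFDerivAt_of_eq y
        (toComplex.toContinuousLinearEquiv : Plane →L[ℝ] ℂ).hasFDerivAt rfl
    have hmul : HasFDerivAt (kernelPrimitive c) _ y := hA'.mul hI
    rw [delZBar_eq_of_hasFDerivAt hmul]
    have hsum : (y 0 : ℂ) + Complex.I * y 1 = toComplex y := by rw [toComplex_apply]; ring
    have i0 : inner ℝ y (EuclideanSpace.single (0 : Fin 2) (1 : ℝ)) = y 0 := by
      simp [EuclideanSpace.inner_single_right]
    have i1 : inner ℝ y (EuclideanSpace.single (1 : Fin 2) (1 : ℝ)) = y 1 := by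
      simp [EuclideanSpace.inner_single_right]
    simp only [add_apply, smul_apply, ContinuousLinearMap.comp_apply, innerSL_apply_apply,
      Complex.ofRealCLM_apply, i0, i1, ContinuousLinearEquiv.coe_coe,
      LinearIsometryEquiv.coe_toContinuousLinearEquiv, e0, e1, smul_eq_mul]
    have hfin : 2 * (a : ℂ) = (toComplex y)⁻¹ * (2 * a * (y 0 + Complex.I * y 1)) := by
      rw [hsum]; field_simp
    rw [hfin]
    push_cast
    linear_combination (cutoffPrimitive (‖y‖ ^ 2) - cutoffPrimitive (c * ‖y‖ ^ 2) : ℂ) *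
      (-(toComplex y ^ 2)⁻¹) * Complex.I_sq

lemma isTestFunction_kernelPrimitive {c : ℝ} (hc : 1 ≤ c) {x : Plane} (hx : x ∈ ball 0 (1 / 4)) :
    IsTestFunction (fun y => kernelPrimitive c (y - x)) := by
  -- (27/50)² > 7/25, and 27/50 + 1/4 < 1 keeps the support inside the unit disc.
  have hsub : tsupport (fun y => kernelPrimitive c (y - x)) ⊆ closedBall x (27 / 50) := by
    refine closure_minimal (fun y hy => ?_) isClosed_closedBall
    by_contra hlt
    rw [mem_closedBall, dist_eq_norm, not_le] at hlt
    exact hy (kernelPrimitive_eq_zero hc (by nlinarith))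
  refine ⟨?_, ?_, hsub.trans fun y hy => ?_⟩
  · exact (contDiff_iff_contDiffAt.2 (contDiffAt_kernelPrimitive hc)).comp
      (contDiff_id.sub contDiff_const)
  · exact (isCompact_closedBall x _).of_isClosed_subset (isClosed_tsupport _) hsub
  · rw [mem_closedBall] at hy
    rw [mem_ball] at hx ⊢
    linarith [dist_triangle y x 0]

lemma delZBar_comp_sub (φ : Plane → ℂ) (x y : Plane) :
    delZBar (fun z => φ (z - x)) y = delZBar φ (y - x) := by
  simp [delZBar, partialDeriv, fderiv_comp_sub]

/-! ### The mean value property. -/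

/-- The total mass of the radial kernel `y ↦ cutoff (‖y‖²)`. -/
noncomputable def kernelMass : ℝ := ∫ y : Plane, cutoff (‖y‖ ^ 2)

lemma measureReal_ball (x : Plane) {r : ℝ} (hr : 0 ≤ r) :
    (volume : Measure Plane).real (ball x r) = r ^ 2 * Real.pi := by
  rw [measureReal_def, EuclideanSpace.volume_ball_fin_two]
  simp [ENNReal.toReal_mul, ENNReal.toReal_pow, hr, Real.pi_nonneg, mul_comm]

lemma measureReal_closedBall (x : Plane) {r : ℝ} (hr : 0 ≤ r) :
    (volume : Measure Plane).real (closedBall x r) = r ^ 2 * Real.pi := by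
  rw [← measureReal_ball x hr, measureReal_def, measureReal_def,
    Measure.addHaar_closedBall_eq_addHaar_ball]

lemma continuous_kernel (c : ℝ) (x : Plane) :
    Continuous fun y : Plane => cutoff (c * ‖y - x‖ ^ 2) :=
  cutoff.continuous.comp (by fun_prop)

lemma kernel_eq_zero {r : ℝ} (hr : 0 < r) {x y : Plane} (hy : y ∉ closedBall x r) :
    cutoff ((r ^ 2)⁻¹ * ‖y - x‖ ^ 2) = 0 := by
  rw [mem_closedBall, dist_eq_norm, not_le] at hy
  refine cutoff_eq_zero ?_
  rw [abs_of_nonneg (by positivity), ← div_eq_inv_mul, ← div_pow]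
  have : 1 ≤ ‖y - x‖ / r := (one_le_div hr).2 hy.le
  nlinarith

lemma hasCompactSupport_kernel {r : ℝ} (hr : 0 < r) (x : Plane) :
    HasCompactSupport fun y : Plane => cutoff ((r ^ 2)⁻¹ * ‖y - x‖ ^ 2) :=
  HasCompactSupport.intro (isCompact_closedBall x r) fun _ hy => kernel_eq_zero hr hy

lemma integral_kernel {r : ℝ} (hr : 0 < r) (x : Plane) :
    (r ^ 2)⁻¹ * ∫ y : Plane, cutoff ((r ^ 2)⁻¹ * ‖y - x‖ ^ 2) = kernelMass := by
  have h := Measure.integral_comp_smul (volume : Measure Plane)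
    (fun y : Plane => cutoff (‖y‖ ^ 2)) r⁻¹
  rw [integral_sub_right_eq_self (fun y : Plane => cutoff ((r ^ 2)⁻¹ * ‖y‖ ^ 2)) x]
  simp only [norm_smul, mul_pow, norm_inv, Real.norm_eq_abs, inv_pow, sq_abs,
    finrank_euclideanSpace, Fintype.card_fin, inv_inv, smul_eq_mul] at h
  rw [h, abs_of_nonneg (by positivity), ← mul_assoc, inv_mul_cancel₀ (by positivity), one_mul,
    kernelMass]

lemma integrable_kernel_mul {h : Plane → ℂ} (hh : LocallyIntegrable h volume)
    {r : ℝ} (hr : 0 < r) (x : Plane) :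
    Integrable fun y => (cutoff ((r ^ 2)⁻¹ * ‖y - x‖ ^ 2) : ℂ) * h y :=
  hh.integrable_smul_left_of_hasCompactSupport (continuous_kernel _ x)
    (hasCompactSupport_kernel hr x)

/-- A weakly holomorphic function has the mean value property at almost every point. -/
theorem ae_integral_kernel_mul_eq {h : Plane → ℂ} (hh : LocallyIntegrable h volume)
    (hw : ∀ φ, IsTestFunction φ → ∫ x, h x * delZBar φ x = 0) :
    ∀ᵐ x : Plane, x ∈ ball (0 : Plane) (1 / 4) →
      ∫ y, (cutoff (‖y - x‖ ^ 2) : ℂ) * h y = kernelMass * h x := by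
  -- The kernel minus its rescaled copy is half of ∂₀ + i∂₁ applied to a test function, so h
  -- integrates to zero against it.
  have one_scale : ∀ x ∈ ball (0 : Plane) (1 / 4), ∀ r : ℝ, 0 < r → r ≤ 1 →
      ∫ y, (cutoff (‖y - x‖ ^ 2) : ℂ) * h y =
        ((r ^ 2)⁻¹ : ℝ) * ∫ y, (cutoff ((r ^ 2)⁻¹ * ‖y - x‖ ^ 2) : ℂ) * h y := by
    intro x hx r hr hr1
    have hc : 1 ≤ (r ^ 2)⁻¹ := one_le_inv_iff₀.2 ⟨by positivity, pow_le_one₀ hr.le hr1⟩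
    have h0 := hw _ (isTestFunction_kernelPrimitive hc hx)
    have i1 : Integrable fun y => (cutoff (‖y - x‖ ^ 2) : ℂ) * h y := by
      simpa using integrable_kernel_mul hh one_pos x
    have i2 := (integrable_kernel_mul hh hr x).const_mul (((r ^ 2)⁻¹ : ℝ) : ℂ)
    rw [← integral_const_mul, ← sub_eq_zero, ← integral_sub i1 i2,
      ← mul_right_injective₀ (two_ne_zero (α := ℂ)) |>.eq_iff, mul_zero, ← h0,
      ← integral_const_mul]
    congr 1 with y
    rw [delZBar_comp_sub, delZBar_kernelPrimitive hc]
    push_cast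
    ring
  filter_upwards [IsUnifLocDoublingMeasure.ae_tendsto_average_norm_sub volume hh 1] with x hleb hx
  -- At a Lebesgue point let r → 0. The factor π is the area πr² of the disc times the normalisation
  -- r⁻² of the kernel.
  have hlim : Tendsto (fun r : ℝ => Real.pi * ⨍ y in closedBall x r, ‖h y - h x‖) (𝓝[>] 0)
      (𝓝 (Real.pi * 0)) := by
    refine (hleb (fun _ => x) (fun r => r) tendsto_id ?_).const_mul _
    filter_upwards [self_mem_nhdsWithin] with r hr
    exact mem_closedBall_self (by simpa using (Set.mem_Ioi.1 hr).le)
  rw [← sub_eq_zero, ← norm_le_zero_iff]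
  rw [mul_zero] at hlim
  refine ge_of_tendsto hlim ?_
  filter_upwards [Ioc_mem_nhdsGT (zero_lt_one' ℝ)] with r hr
  have hr0 : 0 < r := hr.1
  have i1 := integrable_kernel_mul hh hr0 x
  have i2 : Integrable fun y => (cutoff ((r ^ 2)⁻¹ * ‖y - x‖ ^ 2) : ℂ) * h x :=
    integrable_kernel_mul (locallyIntegrable_const (h x)) hr0 x
  have e : (∫ y, (cutoff (‖y - x‖ ^ 2) : ℂ) * h y) - kernelMass * h x =
      ((r ^ 2)⁻¹ : ℝ) * ∫ y, (cutoff ((r ^ 2)⁻¹ * ‖y - x‖ ^ 2) : ℂ) * (h y - h x) := by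
    simp_rw [mul_sub]
    rw [integral_sub i1 i2, mul_sub, ← one_scale x hx r hr0 hr.2, integral_mul_const,
      integral_complex_ofReal, ← mul_assoc, ← Complex.ofReal_mul, integral_kernel hr0]
  have hint : IntegrableOn (fun y => ‖h y - h x‖) (closedBall x r) :=
    ((hh.sub (locallyIntegrable_const (h x))).integrableOn_isCompact
      (isCompact_closedBall x r)).norm
  have hle : ‖∫ y, (cutoff ((r ^ 2)⁻¹ * ‖y - x‖ ^ 2) : ℂ) * (h y - h x)‖ ≤
      ∫ y in closedBall x r, ‖h y - h x‖ := by
    rw [← integral_indicator measurableSet_closedBall]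
    refine norm_integral_le_of_norm_le (hint.integrable_indicator measurableSet_closedBall)
      (.of_forall fun y => ?_)
    by_cases hy : y ∈ closedBall x r
    · rw [Set.indicator_of_mem hy, norm_mul, Complex.norm_real, Real.norm_eq_abs,
        abs_of_nonneg cutoff.nonneg]
      exact mul_le_of_le_one_left (norm_nonneg _) cutoff.le_one
    · simp [Set.indicator_of_notMem hy, kernel_eq_zero hr0 hy]
  rw [e, norm_mul, Complex.norm_real, Real.norm_eq_abs, abs_of_pos (by positivity),
    setAverage_eq, measureReal_closedBall x hr0.le, smul_eq_mul]
  refine (mul_le_mul_of_nonneg_left hle (by positivity)).trans_eq ?_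
  field_simp

/-! ### Quantitative Liouville estimate. -/

/-- Two points of the quarter disc are less than 1/2 apart, which is where the plateau 1/4 of
`cutoff` comes from. -/
lemma kernel_eq_one {x y : Plane} (hx : x ∈ ball (0 : Plane) (1 / 4))
    (hy : y ∈ ball (0 : Plane) (1 / 4)) : cutoff (‖y - x‖ ^ 2) = 1 := by
  rw [mem_ball_zero_iff] at hx hy
  refine cutoff_eq_one ?_
  rw [abs_of_nonneg (by positivity)]
  nlinarith [norm_sub_le y x, norm_nonneg (y - x)]

lemma kernel_eq_zero_of_notMem {x y : Plane} (hx : x ∈ ball (0 : Plane) (1 / 4))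
    (hy : y ∉ unitDisc) : cutoff (‖y - x‖ ^ 2) = 0 := by
  rw [mem_ball_zero_iff] at hx hy
  refine cutoff_eq_zero ?_
  rw [abs_of_nonneg (by positivity)]
  nlinarith [norm_sub_norm_le y x, norm_nonneg (y - x)]

lemma integral_kernel_one (x : Plane) : ∫ y : Plane, cutoff (‖y - x‖ ^ 2) = kernelMass := by
  simpa using integral_kernel one_pos x

lemma integrable_kernel (x : Plane) : Integrable fun y : Plane => cutoff (‖y - x‖ ^ 2) := by
  have h := (continuous_kernel ((1 ^ 2)⁻¹) x).integrable_of_hasCompactSupport (μ := volume)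
    (hasCompactSupport_kernel one_pos x)
  simpa using h

lemma MeasureTheory.Integrable.kernel_mul {k : Plane → ℝ} (hk : Integrable k) (x : Plane) :
    Integrable fun y => cutoff (‖y - x‖ ^ 2) * k y := by
  refine hk.bdd_mul (c := 1) (integrable_kernel x).aestronglyMeasurable (.of_forall fun y => ?_)
  rw [Real.norm_eq_abs, abs_of_nonneg cutoff.nonneg]
  exact cutoff.le_one

lemma kernelMass_nonneg : 0 ≤ kernelMass := integral_nonneg fun _ => cutoff.nonneg

lemma kernelMass_le : kernelMass ≤ 22 / 25 := by
  have hs : (volume : Measure Plane).real (ball 0 √(7 / 25)) = 7 / 25 * Real.pi := by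
    rw [measureReal_ball _ (Real.sqrt_nonneg _), Real.sq_sqrt (by norm_num)]
  have hle : kernelMass ≤ ∫ y : Plane, (ball (0 : Plane) √(7 / 25)).indicator 1 y := by
    refine integral_mono (by simpa using integrable_kernel 0)
      ((integrable_indicator_iff measurableSet_ball).2 (integrableOn_const measure_ball_lt_top.ne))
      fun y => ?_
    by_cases hy : y ∈ ball (0 : Plane) √(7 / 25)
    · rw [Set.indicator_of_mem hy]
      exact cutoff.le_one
    · rw [mem_ball_zero_iff, not_lt] at hy
      have h2 : 7 / 25 ≤ ‖y‖ ^ 2 := (Real.sqrt_le_left (norm_nonneg y)).1 hy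
      rw [show cutoff (‖y‖ ^ 2) = 0 from cutoff_eq_zero (h2.trans (le_abs_self _))]
      exact Set.indicator_nonneg (fun _ _ => zero_le_one) y
  rw [integral_indicator measurableSet_ball] at hle
  simp only [Pi.one_apply, setIntegral_const, hs, smul_eq_mul, mul_one] at hle
  linarith [Real.pi_lt_d4]

/-- The variance of `h` about `h x`, in terms of the mean of `‖h‖²`. -/
lemma setIntegral_norm_sub_sq_le {h : Plane → ℂ} (hh : MemLp h 2 volume) {x : Plane}
    (hx : x ∈ ball (0 : Plane) (1 / 4))
    (hmv : ∫ y, (cutoff (‖y - x‖ ^ 2) : ℂ) * h y = kernelMass * h x) :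
    ∫ y in ball (0 : Plane) (1 / 4), ‖h y - h x‖ ^ 2 ≤
      (∫ y, cutoff (‖y - x‖ ^ 2) * ‖h y‖ ^ 2) - kernelMass * ‖h x‖ ^ 2 := by
  have i0 : Integrable fun y => cutoff (‖y - x‖ ^ 2) * ‖h y‖ ^ 2 :=
    hh.norm.integrable_sq.kernel_mul x
  have i1 : Integrable fun y => (cutoff (‖y - x‖ ^ 2) : ℂ) * h y := by
    simpa using integrable_kernel_mul (hh.locallyIntegrable (by norm_num)) one_pos x
  have i2 : Integrable fun y => ((conj (h x)) * ((cutoff (‖y - x‖ ^ 2) : ℂ) * h y)).re :=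
    (i1.const_mul _).re
  have i3 : Integrable fun y => cutoff (‖y - x‖ ^ 2) * ‖h x‖ ^ 2 :=
    (integrable_kernel x).mul_const _
  have hpt : ∀ y, cutoff (‖y - x‖ ^ 2) * ‖h y - h x‖ ^ 2 =
      cutoff (‖y - x‖ ^ 2) * ‖h y‖ ^ 2 -
        2 * ((conj (h x)) * ((cutoff (‖y - x‖ ^ 2) : ℂ) * h y)).re +
        cutoff (‖y - x‖ ^ 2) * ‖h x‖ ^ 2 := by
    intro y
    simp only [Complex.sq_norm, Complex.normSq_apply, Complex.sub_re, Complex.sub_im,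
      Complex.mul_re, Complex.mul_im, Complex.conj_re, Complex.conj_im, Complex.ofReal_re,
      Complex.ofReal_im]
    ring
  have i02 : Integrable fun y => cutoff (‖y - x‖ ^ 2) * ‖h y‖ ^ 2 -
      2 * ((conj (h x)) * ((cutoff (‖y - x‖ ^ 2) : ℂ) * h y)).re := i0.sub (i2.const_mul 2)
  -- The mean value property evaluates the cross term.
  have hmid : ∫ y, ((conj (h x)) * ((cutoff (‖y - x‖ ^ 2) : ℂ) * h y)).re =
      kernelMass * ‖h x‖ ^ 2 := by
    have h1 := integral_re (𝕜 := ℂ) (i1.const_mul (conj (h x)))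
    simp only [RCLike.re_eq_complex_re] at h1
    rw [h1, integral_const_mul, hmv, mul_left_comm, Complex.conj_mul']
    norm_cast
  have hint : Integrable fun y => cutoff (‖y - x‖ ^ 2) * ‖h y - h x‖ ^ 2 := by
    simp_rw [hpt]; exact i02.add i3
  have heq : ∫ y, cutoff (‖y - x‖ ^ 2) * ‖h y - h x‖ ^ 2 =
      (∫ y, cutoff (‖y - x‖ ^ 2) * ‖h y‖ ^ 2) - kernelMass * ‖h x‖ ^ 2 := by
    simp_rw [hpt]
    rw [integral_add i02 i3, integral_sub i0 (i2.const_mul 2),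
      integral_const_mul, hmid, integral_mul_const, integral_kernel_one]
    ring
  rw [← heq, ← integral_indicator measurableSet_ball]
  refine integral_mono_of_nonneg (.of_forall fun y => Set.indicator_nonneg (by intros; positivity) y)
    hint (.of_forall fun y => ?_)
  by_cases hy : y ∈ ball (0 : Plane) (1 / 4)
  · simp only [Set.indicator_of_mem hy, kernel_eq_one hx hy, one_mul, le_refl]
  · simp only [Set.indicator_of_notMem hy]
    exact mul_nonneg cutoff.nonneg (by positivity)

/-- If `‖h‖` is close to `1` in `L²` of the unit disc, then so is the weighted mean of `‖h‖²`. -/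
lemma integral_kernel_mul_norm_sq_le {h : Plane → ℂ} (hh : MemLp h 2 volume) {x : Plane}
    (hx : x ∈ ball (0 : Plane) (1 / 4)) {ε : ℝ}
    (hb : ∫ y in unitDisc, (‖h y‖ - 1) ^ 2 ≤ ε ^ 4) :
    ∫ y, cutoff (‖y - x‖ ^ 2) * ‖h y‖ ^ 2 ≤
      kernelMass + (kernelMass + 1) * ε ^ 2 + ε ^ 4 := by
  have i0 : Integrable fun y => cutoff (‖y - x‖ ^ 2) * ‖h y‖ ^ 2 :=
    hh.norm.integrable_sq.kernel_mul x
  have ib : IntegrableOn (fun y => (‖h y‖ - 1) ^ 2) unitDisc := by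
    have : IsFiniteMeasure (volume.restrict unitDisc) :=
      isFiniteMeasure_restrict.2 measure_ball_lt_top.ne
    exact ((hh.restrict unitDisc).norm.sub (memLp_const 1)).integrable_sq
  have ib' : Integrable (unitDisc.indicator fun y => (‖h y‖ - 1) ^ 2) :=
    ib.integrable_indicator measurableSet_ball
  rw [← integral_indicator measurableSet_ball] at hb
  -- Young's inequality with a free weight: |h|² ≤ (1 + t) + (1 + 1/t)(|h| - 1)².
  have step : ∀ t : ℝ, 0 < t → ∫ y, cutoff (‖y - x‖ ^ 2) * ‖h y‖ ^ 2 ≤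
      (1 + t) * kernelMass + (1 + t⁻¹) * ε ^ 4 := by
    intro t ht
    have hm : ∫ y, cutoff (‖y - x‖ ^ 2) * ‖h y‖ ^ 2 ≤
        ∫ y, ((1 + t) * cutoff (‖y - x‖ ^ 2) +
          (1 + t⁻¹) * unitDisc.indicator (fun y => (‖h y‖ - 1) ^ 2) y) := by
      refine integral_mono i0 (((integrable_kernel x).const_mul _).add (ib'.const_mul _))
        fun y => ?_
      by_cases hy : y ∈ unitDisc
      · simp only [Set.indicator_of_mem hy]
        have h0 : 0 ≤ cutoff (‖y - x‖ ^ 2) := cutoff.nonneg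
        have h1 : cutoff (‖y - x‖ ^ 2) ≤ 1 := cutoff.le_one
        have hyoung : ‖h y‖ ^ 2 ≤ (1 + t) + (1 + t⁻¹) * (‖h y‖ - 1) ^ 2 := by
          have : 0 ≤ t⁻¹ * (t - (‖h y‖ - 1)) ^ 2 := by positivity
          have e : t⁻¹ * (t - (‖h y‖ - 1)) ^ 2 =
            t - 2 * (‖h y‖ - 1) + t⁻¹ * (‖h y‖ - 1) ^ 2 := by
            field_simp; ring
          nlinarith
        calc _ ≤ cutoff (‖y - x‖ ^ 2) * ((1 + t) + (1 + t⁻¹) * (‖h y‖ - 1) ^ 2) := by gcongr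
          _ = (1 + t) * cutoff (‖y - x‖ ^ 2) +
              cutoff (‖y - x‖ ^ 2) * ((1 + t⁻¹) * (‖h y‖ - 1) ^ 2) := by ring
          _ ≤ _ := add_le_add_right (mul_le_of_le_one_left (by positivity) h1) _
      · simp [Set.indicator_of_notMem hy, kernel_eq_zero_of_notMem hx hy]
    rw [integral_add ((integrable_kernel x).const_mul _) (ib'.const_mul _), integral_const_mul,
      integral_const_mul, integral_kernel_one] at hm
    refine hm.trans ?_
    gcongr
  have hM := kernelMass_nonneg
  refine le_of_forall_pos_le_add fun η hη => ?_
  -- The intended weight is t = ε²; the extra s keeps it positive when ε = 0.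
  set s := η / (kernelMass + 1) with hs
  have hs0 : 0 < s := by positivity
  have h1 := step (ε ^ 2 + s) (by positivity)
  have h2 : (ε ^ 2 + s)⁻¹ * ε ^ 4 ≤ ε ^ 2 := by
    rw [inv_mul_le_iff₀ (by positivity)]
    nlinarith [sq_nonneg ε]
  have h3 : s * kernelMass ≤ η := by
    rw [hs, div_mul_eq_mul_div, div_le_iff₀ (by positivity)]
    nlinarith
  nlinarith

lemma exists_unimodular_norm_sub_sq (z : ℂ) :
    ∃ r : ℂ, ‖r‖ = 1 ∧ ‖z - r‖ ^ 2 = (‖z‖ - 1) ^ 2 := by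
  have hr1 : ‖Complex.exp (z.arg * Complex.I)‖ = 1 := Complex.norm_exp_ofReal_mul_I _
  refine ⟨_, hr1, ?_⟩
  have : z - Complex.exp (z.arg * Complex.I) =
      ((‖z‖ - 1 : ℝ) : ℂ) * Complex.exp (z.arg * Complex.I) := by
    conv_lhs => enter [1]; rw [← Complex.norm_mul_exp_arg_mul_I z]
    push_cast
    ring
  rw [this, norm_mul, hr1, mul_one, Complex.norm_real, Real.norm_eq_abs, sq_abs]

/-- A quantitative Liouville-type statement: if `∂f/∂z̄ = ∂g/∂z` weakly, `‖f‖` is close to `1` and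
`g` is small, then `f` is close to a unimodular constant on a smaller disc. -/
theorem exists_unimodular_approx {f g : Plane → ℂ} (hf : MemLp f 2 volume)
    (hg : MemLp g 2 volume)
    (hfg : ∀ φ, IsTestFunction φ → ∫ x, f x * delZBar φ x = ∫ x, g x * delZ φ x)
    {ε : ℝ} (hε : |ε| ≤ 1 / 4)
    (hsmall : 2 * (∫ y in unitDisc, (‖f y‖ - 1) ^ 2) + 2 * (∫ y, ‖g y‖ ^ 2) ≤ ε ^ 4) :
    ∃ r : ℂ, ‖r‖ = 1 ∧
      ∫ y in ball (0 : Plane) (1 / 4), ‖f y - r‖ ^ 2 ≤ 15 / 2 * ε ^ 2 + 15 * ε ^ 4 := by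
  obtain ⟨h, hh, hw, hfh⟩ := exists_weakly_holomorphic_approx hf hg hfg
  have hfin : IsFiniteMeasure (volume.restrict unitDisc) :=
    isFiniteMeasure_restrict.2 measure_ball_lt_top.ne
  have hfin' : IsFiniteMeasure (volume.restrict (ball (0 : Plane) (1 / 4))) :=
    isFiniteMeasure_restrict.2 measure_ball_lt_top.ne
  have ifh : Integrable fun y => ‖f y - h y‖ ^ 2 := (hf.sub hh).norm.integrable_sq
  have iF : IntegrableOn (fun y => (‖f y‖ - 1) ^ 2) unitDisc :=
    ((hf.restrict unitDisc).norm.sub (memLp_const 1)).integrable_sq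
  have iH : IntegrableOn (fun y => (‖h y‖ - 1) ^ 2) unitDisc :=
    ((hh.restrict unitDisc).norm.sub (memLp_const 1)).integrable_sq
  have hfh' : ∀ s, ∫ y in s, ‖f y - h y‖ ^ 2 ≤ ∫ y, ‖g y‖ ^ 2 := fun s =>
    (setIntegral_le_integral ifh (.of_forall fun y => by positivity)).trans hfh
  have hsub : ball (0 : Plane) (1 / 4) ⊆ unitDisc := ball_subset_ball (by norm_num)
  have hb : ∫ y in unitDisc, (‖h y‖ - 1) ^ 2 ≤ ε ^ 4 := by
    have hm : ∫ y in unitDisc, (‖h y‖ - 1) ^ 2 ≤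
        ∫ y in unitDisc, (2 * (‖f y‖ - 1) ^ 2 + 2 * ‖f y - h y‖ ^ 2) := by
      refine integral_mono iH ((iF.const_mul 2).add (ifh.integrableOn.const_mul 2)) fun y => ?_
      have h1 : (‖h y‖ - ‖f y‖) ^ 2 ≤ ‖f y - h y‖ ^ 2 := by
        rw [← sq_abs, norm_sub_rev]
        exact pow_le_pow_left₀ (abs_nonneg _) (abs_norm_sub_norm_le _ _) 2
      simp only
      nlinarith [sq_nonneg ((‖f y‖ - 1) - (‖h y‖ - ‖f y‖))]
    rw [integral_add (iF.const_mul 2) (ifh.integrableOn.const_mul 2), integral_const_mul,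
      integral_const_mul] at hm
    linarith [hfh' unitDisc]
  have hvol : (volume.restrict (ball (0 : Plane) (1 / 4))).real Set.univ = Real.pi / 16 := by
    rw [measureReal_restrict_apply_univ, measureReal_ball _ (by norm_num)]; ring
  -- Some point outside the null set where the mean value property fails does not exceed the
  -- average; the double negation is membership in the complement of that set.
  obtain ⟨x, hxN, hxle⟩ : ∃ x, ¬ ¬ (x ∈ ball (0 : Plane) (1 / 4) ∧
      ∫ y, (cutoff (‖y - x‖ ^ 2) : ℂ) * h y = kernelMass * h x) ∧
      (‖h x‖ - 1) ^ 2 ≤ ⨍ y in ball (0 : Plane) (1 / 4), (‖h y‖ - 1) ^ 2 := by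
    refine exists_notMem_null_le_average ?_ (iH.mono_set hsub) (N := {x | ¬ (_ ∧ _)}) ?_
    · intro h0
      rw [h0] at hvol
      simp at hvol
      linarith [Real.pi_pos]
    · rw [← ae_iff]
      filter_upwards [ae_restrict_mem measurableSet_ball, ae_restrict_of_ae
        (ae_integral_kernel_mul_eq (hh.locallyIntegrable (by norm_num)) hw)] with x h1 h2
      exact ⟨h1, h2 h1⟩
  obtain ⟨hx, hmv⟩ := not_not.1 hxN
  have hbx : (‖h x‖ - 1) ^ 2 * (Real.pi / 16) ≤ ε ^ 4 := by
    rw [average_eq, hvol, smul_eq_mul, ← div_eq_inv_mul, le_div_iff₀ (by positivity)] at hxle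
    refine hxle.trans (le_trans ?_ hb)
    exact setIntegral_mono_set iH (.of_forall fun y => by positivity) hsub.eventuallyLE
  have hvar := (setIntegral_norm_sub_sq_le hh hx hmv).trans
    (sub_le_sub_right (integral_kernel_mul_norm_sq_le hh hx hb) _)
  have hε2 : ε ^ 2 ≤ 1 / 16 := by rw [← sq_abs]; nlinarith [abs_nonneg ε]
  -- (113/50)² > 16/π.
  have hb1 : 1 - ‖h x‖ ≤ 113 / 50 * ε ^ 2 := by
    refine le_of_abs_le (abs_le_of_sq_le_sq ?_ (by positivity))
    nlinarith [Real.pi_gt_d2, sq_nonneg (‖h x‖ - 1)]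
  -- The three contributions are (22/25)(113/25), 22/25 + 1 and at most 1/16, with sum below 6.
  have hvar6 : ∫ y in ball (0 : Plane) (1 / 4), ‖h y - h x‖ ^ 2 ≤ 6 * ε ^ 2 := by
    have hM := kernelMass_nonneg
    have hM' := kernelMass_le
    have h1 : kernelMass * (1 - ‖h x‖ ^ 2) ≤ 22 / 25 * (113 / 25 * ε ^ 2) := by
      calc kernelMass * (1 - ‖h x‖ ^ 2) ≤ kernelMass * (113 / 25 * ε ^ 2) := by
            gcongr; nlinarith [sq_nonneg (‖h x‖ - 1)]
        _ ≤ _ := by gcongr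
    nlinarith [sq_nonneg ε]
  obtain ⟨r, hr1, hrx⟩ := exists_unimodular_norm_sub_sq (h x)
  refine ⟨r, hr1, ?_⟩
  have ihx : IntegrableOn (fun y => ‖h y - h x‖ ^ 2) (ball (0 : Plane) (1 / 4)) :=
    ((hh.restrict _).sub (memLp_const (h x))).norm.integrable_sq
  have ic : IntegrableOn (fun _ : Plane => 10 * (‖h x‖ - 1) ^ 2) (ball (0 : Plane) (1 / 4)) :=
    integrable_const _
  have isum : IntegrableOn (fun y => 5 / 4 * ‖h y - h x‖ ^ 2 + 10 * ‖f y - h y‖ ^ 2)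
      (ball (0 : Plane) (1 / 4)) := (ihx.const_mul _).add (ifh.integrableOn.const_mul _)
  have hm : ∫ y in ball (0 : Plane) (1 / 4), ‖f y - r‖ ^ 2 ≤
      ∫ y in ball (0 : Plane) (1 / 4), (5 / 4 * ‖h y - h x‖ ^ 2 + 10 * ‖f y - h y‖ ^ 2 +
        10 * (‖h x‖ - 1) ^ 2) := by
    refine integral_mono (((hf.restrict _).sub (memLp_const r)).norm.integrable_sq)
      (isum.add ic) fun y => ?_
    have h1 : ‖f y - r‖ ≤ ‖h y - h x‖ + (‖f y - h y‖ + ‖h x - r‖) := by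
      calc ‖f y - r‖ = ‖(f y - h y) + (h y - h x) + (h x - r)‖ := by congr 1; ring
        _ ≤ _ := by linarith [norm_add₃_le (a := f y - h y) (b := h y - h x) (c := h x - r)]
    simp only [← hrx]
    have h2 := pow_le_pow_left₀ (norm_nonneg _) h1 2
    -- (a + b + c)² ≤ (5/4)a² + 5(b + c)² ≤ (5/4)a² + 10b² + 10c².
    nlinarith [sq_nonneg (‖h y - h x‖ - 4 * (‖f y - h y‖ + ‖h x - r‖)),
      sq_nonneg (‖f y - h y‖ - ‖h x - r‖)]
  rw [integral_add isum ic,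
    integral_add (ihx.const_mul _) (ifh.integrableOn.const_mul _), integral_const_mul,
    integral_const_mul, integral_const, hvol, smul_eq_mul] at hm
  have hF0 : 0 ≤ ∫ y in unitDisc, (‖f y‖ - 1) ^ 2 := integral_nonneg fun y => by positivity
  nlinarith [hfh' (ball (0 : Plane) (1 / 4))]

/-! ### Conformal splitting and the distance to SO(2). -/

/-- The conformal part of a real `2 × 2` matrix, as a complex number. -/
noncomputable def conformalPart (A : Matrix (Fin 2) (Fin 2) ℝ) : ℂ :=
  ⟨(A 0 0 + A 1 1) / 2, (A 1 0 - A 0 1) / 2⟩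

/-- The anticonformal part of a real `2 × 2` matrix, as a complex number. -/
noncomputable def anticonformalPart (A : Matrix (Fin 2) (Fin 2) ℝ) : ℂ :=
  ⟨(A 0 0 - A 1 1) / 2, (A 1 0 + A 0 1) / 2⟩

/-- Multiplication by a complex number, as a real matrix. -/
def complexMatrix (r : ℂ) : Matrix (Fin 2) (Fin 2) ℝ := !![r.re, -r.im; r.im, r.re]

lemma frobenius_norm_sq (A : Matrix (Fin 2) (Fin 2) ℝ) :
    ‖A‖ ^ 2 = 2 * ‖conformalPart A‖ ^ 2 + 2 * ‖anticonformalPart A‖ ^ 2 := by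
  have h : ‖A‖ ^ 2 = ∑ i, ∑ j, A i j ^ 2 := by
    rw [Matrix.frobenius_norm_def, ← Real.sqrt_eq_rpow, Real.sq_sqrt (by positivity)]
    simp
  rw [h, Complex.sq_norm, Complex.sq_norm, Complex.normSq_apply, Complex.normSq_apply]
  simp [Fin.sum_univ_two, conformalPart, anticonformalPart]
  ring

lemma frobenius_norm_sub_complexMatrix_sq (A : Matrix (Fin 2) (Fin 2) ℝ) (r : ℂ) :
    ‖A - complexMatrix r‖ ^ 2 = 2 * ‖conformalPart A - r‖ ^ 2 + 2 * ‖anticonformalPart A‖ ^ 2 := by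
  rw [frobenius_norm_sq]
  congr 3
  · congr 1
    apply Complex.ext <;> simp [conformalPart, complexMatrix] <;> ring
  · congr 1
    apply Complex.ext <;> simp [anticonformalPart, complexMatrix]

lemma complexMatrix_mem {r : ℂ} (hr : ‖r‖ = 1) :
    complexMatrix r ∈ Matrix.specialOrthogonalGroup (Fin 2) ℝ := by
  have h : r.re * r.re + r.im * r.im = 1 := by
    rw [← Complex.normSq_apply, ← Complex.sq_norm, hr, one_pow]
  rw [Matrix.mem_specialOrthogonalGroup_iff, Matrix.mem_orthogonalGroup_iff]
  constructor
  · ext i j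
    fin_cases i <;> fin_cases j <;>
      simp [complexMatrix, Matrix.mul_apply, Fin.sum_univ_two] <;> linarith
  · simp [complexMatrix, Matrix.det_fin_two, h]

lemma exists_eq_complexMatrix {R : Matrix (Fin 2) (Fin 2) ℝ}
    (hR : R ∈ Matrix.specialOrthogonalGroup (Fin 2) ℝ) : ∃ r : ℂ, ‖r‖ = 1 ∧ R = complexMatrix r := by
  rw [Matrix.mem_specialOrthogonalGroup_iff, Matrix.mem_orthogonalGroup_iff] at hR
  obtain ⟨hO, hdet⟩ := hR
  rw [Matrix.det_fin_two] at hdet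
  have h00 := congr_fun₂ hO 0 0
  have h11 := congr_fun₂ hO 1 1
  simp [Matrix.mul_apply, Fin.sum_univ_two] at h00 h11
  -- The left side is |R|² - 2 det R = 2 - 2.
  have hsq : (R 0 0 - R 1 1) ^ 2 + (R 0 1 + R 1 0) ^ 2 = 0 := by nlinarith
  have ha : R 0 0 - R 1 1 = 0 := by nlinarith [sq_nonneg (R 0 0 - R 1 1), sq_nonneg (R 0 1 + R 1 0)]
  have hb : R 0 1 + R 1 0 = 0 := by nlinarith [sq_nonneg (R 0 0 - R 1 1), sq_nonneg (R 0 1 + R 1 0)]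
  refine ⟨⟨R 0 0, R 1 0⟩, ?_, ?_⟩
  · rw [← sq_eq_sq₀ (norm_nonneg _) zero_le_one, Complex.sq_norm, Complex.normSq_apply]
    simp only
    rw [show R 1 0 = - R 0 1 by linarith]
    linarith
  · ext i j
    fin_cases i <;> fin_cases j <;> simp [complexMatrix] <;> linarith

/-- Rotations have no anticonformal part, so the nearest one is the phase of the conformal part. -/
lemma distSO2_sq (A : Matrix (Fin 2) (Fin 2) ℝ) :
    distSO2 A ^ 2 = 2 * (‖conformalPart A‖ - 1) ^ 2 + 2 * ‖anticonformalPart A‖ ^ 2 := by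
  obtain ⟨r, hr, hAr⟩ := exists_unimodular_norm_sub_sq (conformalPart A)
  refine le_antisymm ?_ ?_
  · rw [← hAr, ← frobenius_norm_sub_complexMatrix_sq, ← dist_eq_norm]
    exact pow_le_pow_left₀ infDist_nonneg (infDist_le_dist_of_mem (complexMatrix_mem hr)) 2
  · rw [distSO2, ← Real.sqrt_le_left infDist_nonneg]
    refine (le_infDist ⟨_, complexMatrix_mem hr⟩).2 fun {R} hR => ?_
    obtain ⟨s, hs, rfl⟩ := exists_eq_complexMatrix hR
    rw [dist_eq_norm, Real.sqrt_le_left (norm_nonneg _), frobenius_norm_sub_complexMatrix_sq]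
    have h1 : (‖conformalPart A‖ - 1) ^ 2 ≤ ‖conformalPart A - s‖ ^ 2 := by
      rw [← sq_abs, ← hs]
      exact pow_le_pow_left₀ (abs_nonneg _) (abs_norm_sub_norm_le _ _) 2
    linarith

/-! ### The first-order equation satisfied by a gradient. -/

section Gradient

variable {u : Plane → Plane} {Du : Plane → Matrix (Fin 2) (Fin 2) ℝ}

/-- The mixed second derivatives agree weakly. -/
lemma IsW12WithGradient.integral_gradient_mul_partialDeriv
    (hu : IsW12WithGradient unitDisc u Du) (i : Fin 2) {φ : Plane → ℝ} (hφ : IsTestFunction φ) :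
    ∫ x in unitDisc, Du x i 0 * partialDeriv 1 φ x =
      ∫ x in unitDisc, Du x i 1 * partialDeriv 0 φ x := by
  have parts : ∀ j k : Fin 2, ∫ x in unitDisc, u x i * partialDeriv j (partialDeriv k φ) x =
      -∫ x in unitDisc, Du x i j * partialDeriv k φ x := fun j k =>
    hu.integral_by_parts i j _ (hφ.partialDeriv k).contDiff (hφ.partialDeriv k).hasCompactSupport
      (hφ.partialDeriv k).tsupport_subset
  have h01 := parts 0 1
  have h10 := parts 1 0
  simp_rw [partialDeriv_comm hφ.contDiff 0 1] at h01
  rw [h01] at h10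
  exact neg_injective h10

lemma IsW12WithGradient.integrable_gradient_mul (hu : IsW12WithGradient unitDisc u Du)
    (i j : Fin 2) {φ : Plane → ℂ} (hφ : IsTestFunction φ) :
    IntegrableOn (fun x => (Du x i j : ℂ) * φ x) unitDisc :=
  (hu.memLp_gradient i j).ofReal.integrable_mul ((hφ.memLp 2).restrict _)

lemma IsW12WithGradient.integral_gradient_mul_partialDeriv_complex
    (hu : IsW12WithGradient unitDisc u Du) (i : Fin 2) {φ : Plane → ℂ} (hφ : IsTestFunction φ) :
    ∫ x in unitDisc, (Du x i 0 : ℂ) * partialDeriv 1 φ x =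
      ∫ x in unitDisc, (Du x i 1 : ℂ) * partialDeriv 0 φ x := by
  have hre := hu.integral_gradient_mul_partialDeriv i (hφ.clm_comp Complex.reCLM)
  have him := hu.integral_gradient_mul_partialDeriv i (hφ.clm_comp Complex.imCLM)
  simp_rw [partialDeriv_clm_comp hφ.differentiable] at hre him
  have i0 := hu.integrable_gradient_mul i 0 (hφ.partialDeriv 1)
  have i1 := hu.integrable_gradient_mul i 1 (hφ.partialDeriv 0)
  apply Complex.ext
  · have e0 := integral_re (𝕜 := ℂ) i0
    have e1 := integral_re (𝕜 := ℂ) i1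
    simp only [RCLike.re_eq_complex_re, Complex.re_ofReal_mul] at e0 e1
    rw [← e0, ← e1]
    exact hre
  · have e0 := integral_im (𝕜 := ℂ) i0
    have e1 := integral_im (𝕜 := ℂ) i1
    simp only [RCLike.im_eq_complex_im, Complex.im_ofReal_mul] at e0 e1
    rw [← e0, ← e1]
    exact him

lemma conformalPart_eq (A : Matrix (Fin 2) (Fin 2) ℝ) :
    conformalPart A = ((A 0 0 : ℂ) + A 1 1 + Complex.I * (A 1 0 - A 0 1)) / 2 := by
  apply Complex.ext <;> simp [conformalPart]

lemma anticonformalPart_eq (A : Matrix (Fin 2) (Fin 2) ℝ) :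
    anticonformalPart A = ((A 0 0 : ℂ) - A 1 1 + Complex.I * (A 1 0 + A 0 1)) / 2 := by
  apply Complex.ext <;> simp [anticonformalPart]

lemma IsW12WithGradient.memLp_conformalPart (hu : IsW12WithGradient unitDisc u Du) :
    MemLp (fun x => conformalPart (Du x)) 2 (volume.restrict unitDisc) := by
  have h : ∀ i j, MemLp (fun x => (Du x i j : ℂ)) 2 (volume.restrict unitDisc) := fun i j =>
    (hu.memLp_gradient i j).ofReal
  simp_rw [conformalPart_eq, div_eq_mul_inv]
  exact (((h 0 0).add (h 1 1)).add (((h 1 0).sub (h 0 1)).const_mul _)).mul_const _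

lemma IsW12WithGradient.memLp_anticonformalPart (hu : IsW12WithGradient unitDisc u Du) :
    MemLp (fun x => anticonformalPart (Du x)) 2 (volume.restrict unitDisc) := by
  have h : ∀ i j, MemLp (fun x => (Du x i j : ℂ)) 2 (volume.restrict unitDisc) := fun i j =>
    (hu.memLp_gradient i j).ofReal
  simp_rw [anticonformalPart_eq, div_eq_mul_inv]
  exact (((h 0 0).sub (h 1 1)).add (((h 1 0).add (h 0 1)).const_mul _)).mul_const _

/-- The weak form of `∂/∂z̄ (∂u/∂z) = ∂/∂z (∂u/∂z̄)`. -/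
lemma IsW12WithGradient.integral_conformalPart_mul_delZBar (hu : IsW12WithGradient unitDisc u Du)
    {φ : Plane → ℂ} (hφ : IsTestFunction φ) :
    ∫ x in unitDisc, conformalPart (Du x) * delZBar φ x =
      ∫ x in unitDisc, anticonformalPart (Du x) * delZ φ x := by
  have i1 : IntegrableOn (fun x => conformalPart (Du x) * delZBar φ x) unitDisc :=
    hu.memLp_conformalPart.integrable_mul ((hφ.delZBar.memLp 2).restrict _)
  have i2 : IntegrableOn (fun x => anticonformalPart (Du x) * delZ φ x) unitDisc :=
    hu.memLp_anticonformalPart.integrable_mul ((hφ.delZ.memLp 2).restrict _)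
  have j : ∀ i, ∫ x in unitDisc, ((Du x i 0 : ℂ) * partialDeriv 1 φ x -
      (Du x i 1 : ℂ) * partialDeriv 0 φ x) = 0 := fun i => by
    rw [integral_sub (hu.integrable_gradient_mul i 0 (hφ.partialDeriv 1))
      (hu.integrable_gradient_mul i 1 (hφ.partialDeriv 0)),
      hu.integral_gradient_mul_partialDeriv_complex i hφ, sub_self]
  have ij : ∀ i, IntegrableOn (fun x => (Du x i 0 : ℂ) * partialDeriv 1 φ x -
      (Du x i 1 : ℂ) * partialDeriv 0 φ x) unitDisc := fun i =>
    (hu.integrable_gradient_mul i 0 (hφ.partialDeriv 1)).sub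
      (hu.integrable_gradient_mul i 1 (hφ.partialDeriv 0))
  rw [← sub_eq_zero, ← integral_sub i1 i2]
  -- The difference is i times the weak curl of the first row minus that of the second.
  have hpt : ∀ x, conformalPart (Du x) * delZBar φ x - anticonformalPart (Du x) * delZ φ x =
      Complex.I * ((Du x 0 0 : ℂ) * partialDeriv 1 φ x - (Du x 0 1 : ℂ) * partialDeriv 0 φ x) -
      ((Du x 1 0 : ℂ) * partialDeriv 1 φ x - (Du x 1 1 : ℂ) * partialDeriv 0 φ x) := by
    intro x
    rw [conformalPart_eq, anticonformalPart_eq, delZ, delZBar]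
    linear_combination Du x 1 0 * partialDeriv 1 φ x * Complex.I_sq
  simp_rw [hpt]
  rw [integral_sub ((ij 0).const_mul _) (ij 1), integral_const_mul, j, j]
  simp

end Gradient

/-! ### The rigidity estimates. -/

section Rigidity

variable {u : Plane → Plane} {Du : Plane → Matrix (Fin 2) (Fin 2) ℝ}

lemma IsW12WithGradient.integrable_conformal_deficit (hu : IsW12WithGradient unitDisc u Du) :
    IntegrableOn (fun x => (‖conformalPart (Du x)‖ - 1) ^ 2) unitDisc := by
  have : IsFiniteMeasure (volume.restrict unitDisc) :=
    isFiniteMeasure_restrict.2 measure_ball_lt_top.ne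
  exact (hu.memLp_conformalPart.norm.sub (memLp_const 1)).integrable_sq

lemma IsW12WithGradient.integrable_anticonformalPart_sq (hu : IsW12WithGradient unitDisc u Du) :
    IntegrableOn (fun x => ‖anticonformalPart (Du x)‖ ^ 2) unitDisc :=
  hu.memLp_anticonformalPart.norm.integrable_sq

lemma IsW12WithGradient.rotationDeficit_eq (hu : IsW12WithGradient unitDisc u Du) :
    rotationDeficit Du = 2 * (∫ x in unitDisc, (‖conformalPart (Du x)‖ - 1) ^ 2) +
      2 * ∫ x in unitDisc, ‖anticonformalPart (Du x)‖ ^ 2 := by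
  simp_rw [rotationDeficit, distSO2_sq]
  rw [integral_add (hu.integrable_conformal_deficit.const_mul _)
    (hu.integrable_anticonformalPart_sq.const_mul _), integral_const_mul, integral_const_mul]

lemma quarterDisc_subset : ball (0 : Plane) (1 / 4) ⊆ unitDisc := ball_subset_ball (by norm_num)

lemma measureReal_quarterDisc :
    (volume : Measure Plane).real (ball 0 (1 / 4)) = Real.pi / 16 := by
  rw [measureReal_ball _ (by norm_num)]; ring

lemma IsW12WithGradient.integrable_conformalPart_sub_sq (hu : IsW12WithGradient unitDisc u Du)
    (r : ℂ) : IntegrableOn (fun x => ‖conformalPart (Du x) - r‖ ^ 2) unitDisc := by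
  have : IsFiniteMeasure (volume.restrict unitDisc) :=
    isFiniteMeasure_restrict.2 measure_ball_lt_top.ne
  exact (hu.memLp_conformalPart.sub (memLp_const r)).norm.integrable_sq

lemma IsW12WithGradient.integrable_sub_complexMatrix_sq (hu : IsW12WithGradient unitDisc u Du)
    (r : ℂ) : IntegrableOn (fun x => ‖Du x - complexMatrix r‖ ^ 2) (ball (0 : Plane) (1 / 4)) := by
  simp_rw [frobenius_norm_sub_complexMatrix_sq]
  exact (((hu.integrable_conformalPart_sub_sq r).mono_set quarterDisc_subset).const_mul _).add
    ((hu.integrable_anticonformalPart_sq.mono_set quarterDisc_subset).const_mul _)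

lemma IsW12WithGradient.setIntegral_anticonformalPart_sq_le
    (hu : IsW12WithGradient unitDisc u Du) :
    ∫ x in ball (0 : Plane) (1 / 4), ‖anticonformalPart (Du x)‖ ^ 2 ≤
      ∫ x in unitDisc, ‖anticonformalPart (Du x)‖ ^ 2 :=
  setIntegral_mono_set hu.integrable_anticonformalPart_sq (.of_forall fun _ => by positivity)
    quarterDisc_subset.eventuallyLE

/-- The rigidity estimate for small deficit. -/
lemma IsW12WithGradient.exists_rotation_of_small (hu : IsW12WithGradient unitDisc u Du) {ε : ℝ}
    (hε : |ε| ≤ 1 / 4) (hδ : rotationDeficit Du = ε ^ 4) :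
    ∃ r : ℂ, ‖r‖ = 1 ∧ ∫ x in ball (0 : Plane) (1 / 4), ‖Du x - complexMatrix r‖ ^ 2 ≤
      15 * ε ^ 2 + 31 * ε ^ 4 := by
  rw [hu.rotationDeficit_eq] at hδ
  set f : Plane → ℂ := unitDisc.indicator fun x => conformalPart (Du x) with hf
  set g : Plane → ℂ := unitDisc.indicator fun x => anticonformalPart (Du x) with hg
  have hfL : MemLp f 2 volume :=
    (memLp_indicator_iff_restrict measurableSet_ball).2 hu.memLp_conformalPart
  have hgL : MemLp g 2 volume :=
    (memLp_indicator_iff_restrict measurableSet_ball).2 hu.memLp_anticonformalPart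
  have hfg : ∀ φ, IsTestFunction φ → ∫ x, f x * delZBar φ x = ∫ x, g x * delZ φ x := by
    intro φ hφ
    simp_rw [hf, hg, ← Set.indicator_mul_left]
    rw [integral_indicator measurableSet_ball, integral_indicator measurableSet_ball]
    exact hu.integral_conformalPart_mul_delZBar hφ
  have ef : ∫ x in unitDisc, (‖f x‖ - 1) ^ 2 =
      ∫ x in unitDisc, (‖conformalPart (Du x)‖ - 1) ^ 2 :=
    setIntegral_congr_fun measurableSet_ball fun x hx => by simp [hf, Set.indicator_of_mem hx]
  have eg : ∫ x, ‖g x‖ ^ 2 = ∫ x in unitDisc, ‖anticonformalPart (Du x)‖ ^ 2 := by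
    rw [← integral_indicator measurableSet_ball]
    congr 1 with x
    by_cases hx : x ∈ unitDisc <;> simp [hg, hx]
  obtain ⟨r, hr, hfr⟩ := exists_unimodular_approx hfL hgL hfg hε (by rw [ef, eg, hδ])
  refine ⟨r, hr, ?_⟩
  have ef' : ∫ x in ball (0 : Plane) (1 / 4), ‖f x - r‖ ^ 2 =
      ∫ x in ball (0 : Plane) (1 / 4), ‖conformalPart (Du x) - r‖ ^ 2 :=
    setIntegral_congr_fun measurableSet_ball fun x hx => by
      simp [hf, Set.indicator_of_mem (quarterDisc_subset hx)]
  simp_rw [frobenius_norm_sub_complexMatrix_sq]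
  rw [integral_add (((hu.integrable_conformalPart_sub_sq r).mono_set quarterDisc_subset).const_mul _)
    ((hu.integrable_anticonformalPart_sq.mono_set quarterDisc_subset).const_mul _),
    integral_const_mul, integral_const_mul, ← ef']
  have h0 : 0 ≤ ∫ x in unitDisc, (‖conformalPart (Du x)‖ - 1) ^ 2 :=
    integral_nonneg fun _ => by positivity
  linarith [hu.setIntegral_anticonformalPart_sq_le]

/-- One of the rotations `±1` is not too far from any gradient of given deficit. -/
lemma IsW12WithGradient.exists_rotation_trivial (hu : IsW12WithGradient unitDisc u Du) :
    ∃ r : ℂ, ‖r‖ = 1 ∧ ∫ x in ball (0 : Plane) (1 / 4), ‖Du x - complexMatrix r‖ ^ 2 ≤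
      3 / 8 * Real.pi + 2 * rotationDeficit Du := by
  have hsum : (∫ x in ball (0 : Plane) (1 / 4), ‖Du x - complexMatrix 1‖ ^ 2) +
      ∫ x in ball (0 : Plane) (1 / 4), ‖Du x - complexMatrix (-1)‖ ^ 2 ≤
      2 * (3 / 8 * Real.pi + 2 * rotationDeficit Du) := by
    have iF := hu.integrable_conformal_deficit
    have iG := hu.integrable_anticonformalPart_sq
    have iD : IntegrableOn (fun x => 8 * (‖conformalPart (Du x)‖ - 1) ^ 2 +
        8 * ‖anticonformalPart (Du x)‖ ^ 2) unitDisc := (iF.const_mul _).add (iG.const_mul _)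
    have ic : IntegrableOn (fun _ : Plane => (12 : ℝ)) (ball (0 : Plane) (1 / 4)) :=
      integrableOn_const measure_ball_lt_top.ne
    rw [← integral_add (hu.integrable_sub_complexMatrix_sq 1)
      (hu.integrable_sub_complexMatrix_sq (-1))]
    have h1 : ∫ x in ball (0 : Plane) (1 / 4),
        (‖Du x - complexMatrix 1‖ ^ 2 + ‖Du x - complexMatrix (-1)‖ ^ 2) ≤
        ∫ x in ball (0 : Plane) (1 / 4), ((8 * (‖conformalPart (Du x)‖ - 1) ^ 2 +
        8 * ‖anticonformalPart (Du x)‖ ^ 2) + 12) := by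
      refine integral_mono ((hu.integrable_sub_complexMatrix_sq 1).add
        (hu.integrable_sub_complexMatrix_sq (-1))) ((iD.mono_set quarterDisc_subset).add ic)
        fun x => ?_
      simp only [frobenius_norm_sub_complexMatrix_sq]
      have hpar := parallelogram_law_with_norm ℝ (conformalPart (Du x)) 1
      rw [norm_one] at hpar
      rw [sub_neg_eq_add]
      -- 4|f|² + 4 ≤ 8(|f| - 1)² + 12 is 4(|f| - 2)² ≥ 0.
      nlinarith [sq_nonneg (‖conformalPart (Du x)‖ - 2), sq_nonneg ‖anticonformalPart (Du x)‖]
    have h2 : ∫ x in ball (0 : Plane) (1 / 4), (8 * (‖conformalPart (Du x)‖ - 1) ^ 2 +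
        8 * ‖anticonformalPart (Du x)‖ ^ 2) ≤ 4 * rotationDeficit Du := by
      refine (setIntegral_mono_set iD (.of_forall fun _ => by positivity)
        quarterDisc_subset.eventuallyLE).trans_eq ?_
      rw [hu.rotationDeficit_eq, integral_add (iF.const_mul _) (iG.const_mul _),
        integral_const_mul, integral_const_mul]
      ring
    rw [integral_add (iD.mono_set quarterDisc_subset) ic, setIntegral_const,
      measureReal_quarterDisc, smul_eq_mul] at h1
    linarith
  by_cases h : ∫ x in ball (0 : Plane) (1 / 4), ‖Du x - complexMatrix 1‖ ^ 2 ≤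
      3 / 8 * Real.pi + 2 * rotationDeficit Du
  · exact ⟨1, norm_one, h⟩
  · exact ⟨-1, by simp, by linarith⟩

/-- A bound for the mean of a function in terms of the mean of its square. -/
lemma setIntegral_le_of_setIntegral_sq_le {k : Plane → ℝ} (hk0 : ∀ x, 0 ≤ k x)
    (hk : IntegrableOn (fun x => k x ^ 2) (ball (0 : Plane) (1 / 4))) {ε : ℝ} (hε : 0 ≤ ε)
    (hle : ∫ x in ball (0 : Plane) (1 / 4), k x ^ 2 ≤ 100 * ε ^ 2) :
    ∫ x in ball (0 : Plane) (1 / 4), k x ≤ 5 * ε := by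
  have ic : ∀ c : ℝ, IntegrableOn (fun _ : Plane => c) (ball (0 : Plane) (1 / 4)) := fun c =>
    integrableOn_const measure_ball_lt_top.ne
  refine le_of_forall_pos_le_add fun η hη => ?_
  -- Weight in k ≤ s/2 + k²/(2s): at s = 20ε the terms give 10ε · π/16 + 5ε/2 < 5ε, and η keeps s
  -- positive when ε = 0.
  set s := 20 * ε + η with hs
  have hs0 : 0 < s := by positivity
  have h1 : ∫ x in ball (0 : Plane) (1 / 4), k x ≤
      ∫ x in ball (0 : Plane) (1 / 4), (s / 2 + (2 * s)⁻¹ * k x ^ 2) := by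
    refine integral_mono_of_nonneg (.of_forall hk0) ((ic _).add (hk.const_mul _))
      (.of_forall fun x => ?_)
    have h2 : 0 ≤ (2 * s)⁻¹ * (s - k x) ^ 2 := by positivity
    have h3 : (2 * s)⁻¹ * (s - k x) ^ 2 = s / 2 - k x + (2 * s)⁻¹ * k x ^ 2 := by
      field_simp; ring
    simp only
    linarith
  rw [integral_add (ic _) (hk.const_mul _), integral_const_mul, setIntegral_const,
    measureReal_quarterDisc, smul_eq_mul] at h1
  have h2 : (2 * s)⁻¹ * ∫ x in ball (0 : Plane) (1 / 4), k x ^ 2 ≤ 5 / 2 * ε := by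
    rw [inv_mul_le_iff₀ (by positivity)]
    nlinarith
  nlinarith [Real.pi_lt_d2]

end Rigidity

theorem proposition2
    (u : EuclideanSpace ℝ (Fin 2) → EuclideanSpace ℝ (Fin 2))
    (Du : EuclideanSpace ℝ (Fin 2) → Matrix (Fin 2) (Fin 2) ℝ)
    (hu : IsW12WithGradient (ball (0 : EuclideanSpace ℝ (Fin 2)) 1) u Du)
    (hδ : rotationDeficit Du ≤ 1) :
    ∃ R ∈ Matrix.specialOrthogonalGroup (Fin 2) ℝ,
      (∫ x in ball (0 : EuclideanSpace ℝ (Fin 2)) (1 / 4), ‖Du x - R‖ ^ 2) ≤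
          5 * rotationDeficit Du ^ (1 / 4 : ℝ) +
            2 * rotationDeficit Du ^ (1 / 4 : ℝ) * l2NormUnitBall Du ^ (1 / 2 : ℝ) ∧
      (∫ x in ball (0 : EuclideanSpace ℝ (Fin 2)) (1 / 4), ‖Du x - R‖) ≤
          5 * rotationDeficit Du ^ (1 / 4 : ℝ) +
            2 * rotationDeficit Du ^ (1 / 4 : ℝ) * l2NormUnitBall Du ^ (1 / 2 : ℝ) := by
  have hδ0 : 0 ≤ rotationDeficit Du := integral_nonneg fun _ => by positivity
  set ε : ℝ := rotationDeficit Du ^ (1 / 4 : ℝ) with hε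
  have hε0 : 0 ≤ ε := Real.rpow_nonneg hδ0 _
  have hε1 : ε ≤ 1 := Real.rpow_le_one hδ0 hδ (by norm_num)
  have hε4 : rotationDeficit Du = ε ^ 4 := by
    rw [hε, ← Real.rpow_natCast, ← Real.rpow_mul hδ0]
    norm_num
  have hextra : 0 ≤ 2 * ε * l2NormUnitBall Du ^ (1 / 2 : ℝ) :=
    mul_nonneg (by positivity) (Real.rpow_nonneg (Real.sqrt_nonneg _) _)
  -- The linear bound is the first estimate; the quadratic one yields the L¹ estimate.
  suffices h : ∃ r : ℂ, ‖r‖ = 1 ∧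
      ∫ x in ball (0 : Plane) (1 / 4), ‖Du x - complexMatrix r‖ ^ 2 ≤ 5 * ε ∧
      ∫ x in ball (0 : Plane) (1 / 4), ‖Du x - complexMatrix r‖ ^ 2 ≤ 100 * ε ^ 2 by
    obtain ⟨r, hr, h1, h2⟩ := h
    refine ⟨complexMatrix r, complexMatrix_mem hr, by linarith, ?_⟩
    have h3 := setIntegral_le_of_setIntegral_sq_le (fun x => norm_nonneg _)
      (hu.integrable_sub_complexMatrix_sq r) hε0 h2
    linarith
  have h42 : ε ^ 4 ≤ ε ^ 2 := pow_le_pow_of_le_one hε0 hε1 (by norm_num)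
  -- At the threshold 1/4 both regimes fit under 5ε: 15/4 + 31/64 < 5 below it, and 3π/8 + 2/256 <
  -- 5/4 at it.
  rcases le_total ε (1 / 4) with hsmall | hlarge
  · obtain ⟨r, hr, h⟩ := hu.exists_rotation_of_small (by rwa [abs_of_nonneg hε0]) hε4
    have h2 : ε ^ 2 ≤ 1 / 4 * ε := by nlinarith
    have h4 : ε ^ 4 ≤ 1 / 64 * ε := by
      have : ε ^ 3 ≤ (1 / 4) ^ 3 := pow_le_pow_left₀ hε0 hsmall 3
      nlinarith
    exact ⟨r, hr, by linarith, by nlinarith⟩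
  · obtain ⟨r, hr, h⟩ := hu.exists_rotation_trivial
    rw [hε4] at h
    have hpi := Real.pi_lt_d2
    have h3 : ε ^ 3 ≤ 1 := pow_le_one₀ hε0 hε1
    refine ⟨r, hr, ?_, by nlinarith⟩
    -- By convexity 2ε⁴ lies below this line, which meets it at 1/4 and is slightly steeper than the
    -- chord to 1.
    have hc : 2 * ε ^ 4 ≤ 1 / 128 + (ε - 1 / 4) * (8 / 3) := by
      nlinarith [mul_nonneg (sub_nonneg.2 hlarge) (sub_nonneg.2 hε1), sq_nonneg ε,
        mul_nonneg (mul_nonneg (sub_nonneg.2 hlarge) (sub_nonneg.2 hε1)) hε0,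
        mul_nonneg (mul_nonneg (sub_nonneg.2 hlarge) (sub_nonneg.2 hε1)) (sq_nonneg ε)]
    linarith
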